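/- Let $n\ge 2$, let $P_n$ be the path on $n$ vertices with endpoints $u\neq v$, let $A$ and $D$ be its adjacency matrix and degree matrix, and for $k\in\mathbb R$ let $L_k=A+kD$ be the generalized Laplacian. The continuous-time quantum walk generated by a real symmetric matrix $M$ is the one with Hamiltonian $H=-M$, that is, with time evolution $U_M(t)=e^{-iHt}=e^{itM}$; its peak fidelity from $u$ to $v$ is $\sup_{t>0}|U_M(t)_{u,v}|$. Let $E_x=e_xe_x^{\top}$ for a vertex $x$. Then: 1. The vertices $u$ and $v$ are cospectral with $\operatorname{co}(u,v)=\infty$; that is, for every $\ell\ge 0$ the number of closed walks of length $\ell$ at $u$ equals that at $v$. 2. The endpoints $u,v$ have degree $1$ and every other vertex has degree $2$; and, for every $k\in\mathbb R$, the walk generated by $L_k$ is equivalent, up to a global phase (a factor of modulus one that may depend on $t$), to the walk generated by $A+Q(E_u+E_v)$ with $Q=k(1-2)=-k$. 3. For all real $k$ and all $\varepsilon>0$ with $$|k|>\frac{32\sqrt2}{\sqrt\varepsilon},$$ the peak fidelity of the walk generated by $L_k$ satisfies $\sup_{t>0}|U_{L_k}(t)_{u,v}|>1-\varepsilon$; in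 particular, endpoint fidelity at least $1-\varepsilon$ is attained at some time $t>0$. -/

import Mathlib

noncomputable section

namespace QuantumWalk

variable {V : Type*} [Fintype V] [DecidableEq V]

/-- The generalized Laplacian `L_k = A + k D` of a finite simple graph. -/
def genLaplacian (G : SimpleGraph V) [DecidableRel G.Adj] (k : ℝ) : Matrix V V ℝ :=
  G.adjMatrix ℝ + k • G.degMatrix ℝ

/-- The matrix `A + Q (E_u + E_v)`, where `E_x = e_x e_xᵀ`: the adjacency matrix with self-loops
of weight `Q` at `u` and at `v`. -/
def loopMatrix (G : SimpleGraph V) [DecidableRel G.Adj] (u v : V) (Q : ℝ) : Matrix V V ℝ :=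
  G.adjMatrix ℝ + Q • (Matrix.single u u 1 + Matrix.single v v 1)

/-- The time-evolution operator `U(t) = exp (- i H t)` of the Hamiltonian `H`. -/
def evolution (H : Matrix V V ℝ) (t : ℝ) : Matrix V V ℂ :=
  NormedSpace.exp ((-(Complex.I * (t : ℂ))) • H.map Complex.ofReal)

/-- The continuous-time quantum walk generated by the matrix `M`, that is, the time evolution
of the Hamiltonian `H = -M`. -/
def walk (M : Matrix V V ℝ) (t : ℝ) : Matrix V V ℂ :=
  evolution (-M) t

/-- Two walks are equivalent up to a global phase if at each time their evolution operators
differ by a complex factor of modulus one. -/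
def PhaseEquivalent (M N : Matrix V V ℝ) : Prop :=
  ∃ θ : ℝ → ℝ, ∀ t : ℝ, walk M t = Complex.exp (Complex.I * (θ t : ℂ)) • walk N t

/-- The peak transfer fidelity `sup_{t > 0} |U(t)_{u,v}|` of the walk generated by `M`. -/
def peakFidelity (M : Matrix V V ℝ) (u v : V) : ℝ :=
  sSup ((fun t : ℝ => ‖walk M t u v‖) '' Set.Ioi 0)

/-- The number of closed walks of length `l` at `x` in the graph `G`. -/
def closedWalkCount (G : SimpleGraph V) (x : V) (l : ℕ) : ℕ :=
  Nat.card {p : G.Walk x x // p.length = l}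

/-- The cospectrality `co(u,v)`: the largest `m`, possibly infinite, such that for each `l ≤ m`
there are as many closed walks of length `l` at `u` as at `v`. -/
def cospectrality (G : SimpleGraph V) (u v : V) : ℕ∞ :=
  sSup ((fun m : ℕ => (m : ℕ∞)) ''
    {m : ℕ | ∀ l ≤ m, closedWalkCount G u l = closedWalkCount G v l})

end QuantumWalk

end

noncomputable section

namespace QuantumWalk

open scoped Matrix

variable {V : Type*} [Fintype V] [DecidableEq V]

/-! On the path `D = 2I - E_u - E_v`, so `L_k` is `A - k(E_u + E_v)` shifted by `2k`, and the shift
is only a phase. Reversing the path swaps the ends, which gives cospectrality.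

For the fidelity no perturbation theory is needed: `z^j + s z^(m+1-j)` with `s = ±1` is an exact
eigenvector for `z + z⁻¹` once `z` solves one boundary equation (`loopMatrix_mulVec_endVec`). For
large `|Q|` this has a root near `1/Q` for each sign, so both eigenvectors live near the ends.
Scaled to `x`, `x'` with end values `(1, 1)` and `(1, -1)`, they make `(x + x')/2` close to `e_u`
and `(x - x')/2` close to `e_v`. The two eigenvalues differ, so at some time their phases are
opposite; the walk then carries the second combination to a phase times the first, and unitarity
bounds the `(u,v)` entry below by `1 - 40/Q²`. -/

theorem _root_.Matrix.exp_mulVec_of_mulVec_eq_smul {A : Matrix V V ℂ} {c : ℂ} {x : V → ℂ}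
    (h : A *ᵥ x = c • x) : NormedSpace.exp A *ᵥ x = Complex.exp c • x := by
  have hA : HasSum (fun n : ℕ => ((n.factorial : ℂ)⁻¹) • A ^ n) (NormedSpace.exp A) := by
    open scoped Matrix.Norms.Operator in
    exact NormedSpace.exp_series_hasSum_exp' A
  have hc : HasSum (fun n : ℕ => ((n.factorial : ℂ)⁻¹) • c ^ n) (Complex.exp c) := by
    rw [Complex.exp_eq_exp_ℂ]
    exact NormedSpace.exp_series_hasSum_exp' c
  have hpow : ∀ n : ℕ, (A ^ n) *ᵥ x = c ^ n • x := by
    intro n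
    induction n with
    | zero => simp
    | succ n ih =>
      rw [pow_succ, ← Matrix.mulVec_mulVec, h, Matrix.mulVec_smul, ih, smul_smul, pow_succ']
  have h1 := hA.map (Matrix.mulVec.addMonoidHomLeft x)
    (Continuous.matrix_mulVec continuous_id continuous_const)
  have h2 := hc.smul_const x
  refine h1.unique (h2.congr_fun ?_)
  intro n
  simp [Matrix.mulVec.addMonoidHomLeft, Matrix.smul_mulVec, hpow, smul_smul]

theorem walk_eq_exp (M : Matrix V V ℝ) (t : ℝ) :
    walk M t = NormedSpace.exp ((Complex.I * (t : ℂ)) • M.map Complex.ofReal) := by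
  unfold walk evolution
  congr 1
  ext i j
  simp

theorem walk_mulVec_eigenvector {M : Matrix V V ℝ} {c : ℝ} {x : V → ℝ} (h : M *ᵥ x = c • x)
    (t : ℝ) :
    walk M t *ᵥ (fun i => (x i : ℂ)) =
      Complex.exp (Complex.I * t * c) • (fun i => (x i : ℂ)) := by
  rw [walk_eq_exp]
  apply Matrix.exp_mulVec_of_mulVec_eq_smul
  rw [Matrix.smul_mulVec, mul_smul (Complex.I * (t : ℂ)) (c : ℂ)]
  refine congrArg _ (funext fun i => ?_)
  have := congrFun h i
  simp only [Matrix.mulVec, dotProduct, Pi.smul_apply, smul_eq_mul, Matrix.map_apply] at this ⊢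
  exact_mod_cast this

theorem walk_mem_unitaryGroup {M : Matrix V V ℝ} (hM : M.IsSymm) (t : ℝ) :
    walk M t ∈ Matrix.unitaryGroup V ℂ := by
  rw [Matrix.mem_unitaryGroup_iff, walk_eq_exp, Matrix.star_eq_conjTranspose,
    ← Matrix.exp_conjTranspose]
  have : ((Complex.I * (t : ℂ)) • M.map Complex.ofReal)ᴴ =
      -((Complex.I * (t : ℂ)) • M.map Complex.ofReal) := by
    ext i j
    simp [hM.apply i j]
  generalize (Complex.I * (t : ℂ)) • M.map Complex.ofReal = B at this ⊢
  rw [this, ← Matrix.exp_add_of_commute B (-B) (Commute.refl B).neg_right, add_neg_cancel,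
    NormedSpace.exp_zero]

theorem walk_add_smul_one (M : Matrix V V ℝ) (c t : ℝ) :
    walk (M + c • (1 : Matrix V V ℝ)) t =
      Complex.exp (Complex.I * ((c * t : ℝ) : ℂ)) • walk M t := by
  have h : (Complex.I * (t : ℂ)) • (M + c • (1 : Matrix V V ℝ)).map Complex.ofReal =
      (Complex.I * ((c * t : ℝ) : ℂ)) • (1 : Matrix V V ℂ) +
        (Complex.I * (t : ℂ)) • M.map Complex.ofReal := by
    ext i j
    by_cases hij : i = j
    · subst hij; simp; ring
    · simp [hij]
  rw [walk_eq_exp, walk_eq_exp, h, Matrix.exp_add_of_commute _ _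
    ((Commute.one_left _).smul_left _), Matrix.smul_one_eq_diagonal, Matrix.exp_diagonal]
  have : NormedSpace.exp (fun _ : V => Complex.I * ((c * t : ℝ) : ℂ)) =
      fun _ => Complex.exp (Complex.I * ((c * t : ℝ) : ℂ)) := by
    ext i
    rw [Pi.coe_exp, Complex.exp_eq_exp_ℂ]
  rw [this, ← Matrix.smul_one_eq_diagonal, smul_mul_assoc, one_mul]

theorem PhaseEquivalent.peakFidelity_eq {M N : Matrix V V ℝ} (h : PhaseEquivalent M N) (u v : V) :
    peakFidelity M u v = peakFidelity N u v := by
  obtain ⟨θ, h⟩ := h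
  unfold peakFidelity
  congr 1
  refine Set.image_congr fun t _ => ?_
  rw [h t, Matrix.smul_apply, norm_smul, mul_comm Complex.I, Complex.norm_exp_ofReal_mul_I, one_mul]

/-- Unitarity supplies the upper bound 1, without which the real `sSup` would be the default value
0. -/
theorem norm_walk_apply_le_peakFidelity {M : Matrix V V ℝ} (hM : M.IsSymm) (u v : V) {t : ℝ}
    (ht : 0 < t) : ‖walk M t u v‖ ≤ peakFidelity M u v := by
  refine le_csSup ⟨1, ?_⟩ ⟨t, ht, rfl⟩
  rintro _ ⟨s, -, rfl⟩
  exact entry_norm_bound_of_unitary (walk_mem_unitaryGroup hM s) u v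

theorem peakFidelity_nonneg (M : Matrix V V ℝ) (u v : V) : 0 ≤ peakFidelity M u v :=
  Real.sSup_nonneg (by rintro _ ⟨t, -, rfl⟩; exact norm_nonneg _)

theorem _root_.Matrix.norm_toLp_mulVec_of_mem_unitaryGroup {U : Matrix V V ℂ}
    (hU : U ∈ Matrix.unitaryGroup V ℂ) (x : V → ℂ) :
    ‖WithLp.toLp 2 (U *ᵥ x)‖ = ‖WithLp.toLp 2 x‖ := by
  have h1 : ∀ y : V → ℂ, ((‖WithLp.toLp 2 y‖ ^ 2 : ℝ) : ℂ) = star y ⬝ᵥ y := by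
    intro y
    rw [EuclideanSpace.norm_sq_eq]
    simp [dotProduct, Complex.conj_mul']
  have h2 : ((‖WithLp.toLp 2 (U *ᵥ x)‖ ^ 2 : ℝ) : ℂ) = ((‖WithLp.toLp 2 x‖ ^ 2 : ℝ) : ℂ) := by
    rw [h1, h1, Matrix.star_mulVec, Matrix.dotProduct_mulVec, Matrix.vecMul_vecMul,
      ← Matrix.star_eq_conjTranspose, Matrix.mem_unitaryGroup_iff'.mp hU, Matrix.vecMul_one]
  exact (pow_left_inj₀ (norm_nonneg _) (norm_nonneg _) two_ne_zero).mp (Complex.ofReal_injective h2)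

/-- If a unitary matrix sends a vector near `e_v` to a phase multiple of a vector near `e_u`,
its `(u,v)` entry is nearly of modulus one. -/
theorem _root_.Matrix.one_sub_le_norm_apply_of_mem_unitaryGroup {U : Matrix V V ℂ}
    (hU : U ∈ Matrix.unitaryGroup V ℂ) (u v : V) {w w' : V → ℂ} {ω : ℂ} (hω : ‖ω‖ = 1)
    (h : U *ᵥ w' = ω • w) {δ : ℝ}
    (hw : ‖WithLp.toLp 2 (Pi.single u 1 - w)‖ ≤ δ)
    (hw' : ‖WithLp.toLp 2 (Pi.single v 1 - w')‖ ≤ δ) :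
    1 - 2 * δ ^ 2 ≤ ‖U u v‖ := by
  set x : EuclideanSpace ℂ V := WithLp.toLp 2 (U *ᵥ Pi.single v 1) with hx
  set y : EuclideanSpace ℂ V := EuclideanSpace.single u ω with hy
  have hxn : ‖x‖ = 1 := by
    rw [hx, Matrix.norm_toLp_mulVec_of_mem_unitaryGroup hU]
    exact (PiLp.norm_single 2 (fun _ : V => ℂ) v 1).trans norm_one
  have hyn : ‖y‖ = 1 := (PiLp.norm_single 2 (fun _ : V => ℂ) u ω).trans hω
  have hsplit : x - y = WithLp.toLp 2 (U *ᵥ (Pi.single v 1 - w')) -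
      ω • WithLp.toLp 2 (Pi.single u 1 - w) := by
    rw [Matrix.mulVec_sub, h]
    ext i
    by_cases hi : i = u
    · subst hi; simp [hx, hy]; ring
    · simp [hx, hy, hi]
  have hd : ‖x - y‖ ≤ 2 * δ := by
    rw [hsplit]
    refine (norm_sub_le _ _).trans ?_
    rw [Matrix.norm_toLp_mulVec_of_mem_unitaryGroup hU, norm_smul, hω]
    linarith
  have hin : RCLike.re (inner ℂ x y) ≤ ‖U u v‖ := by
    refine (RCLike.re_le_norm _).trans (le_of_eq ?_)
    rw [hy, EuclideanSpace.inner_single_right]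
    simp [hx, hω]
  -- For unit vectors `‖x - y‖² = 2 - 2 Re⟨x, y⟩`, which makes the loss quadratic in `δ`.
  have hsq := norm_sub_sq (𝕜 := ℂ) x y
  rw [hxn, hyn] at hsq
  nlinarith [norm_nonneg (x - y)]

/-! ### Closed walks and cospectrality -/

theorem closedWalkCount_le_of_embedding {G : SimpleGraph V} [DecidableRel G.Adj] (f : G ↪g G)
    (x : V) (l : ℕ) : closedWalkCount G x l ≤ closedWalkCount G (f x) l := by
  unfold closedWalkCount
  -- `Nat.card` of an infinite type is 0, so monotonicity needs a finite target.
  have : Finite {p : G.Walk (f x) (f x) // p.length = l} :=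
    inferInstanceAs (Finite {p : G.Walk (f x) (f x) | p.length = l})
  refine Nat.card_le_card_of_injective (fun p => ⟨p.1.map f.toHom, by simp [p.2]⟩) ?_
  intro p q h
  exact Subtype.ext (SimpleGraph.Walk.map_injective_of_injective f.injective _ _
    (congrArg Subtype.val h))

theorem closedWalkCount_iso {G : SimpleGraph V} [DecidableRel G.Adj] (f : G ≃g G)
    (x : V) (l : ℕ) : closedWalkCount G (f x) l = closedWalkCount G x l := by
  refine le_antisymm ?_ (closedWalkCount_le_of_embedding f.toEmbedding x l)
  simpa using closedWalkCount_le_of_embedding f.symm.toEmbedding (f x) l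

theorem cospectrality_eq_top {V : Type*} {G : SimpleGraph V} {u v : V}
    (h : ∀ l, closedWalkCount G u l = closedWalkCount G v l) : cospectrality G u v = ⊤ := by
  rw [cospectrality, sSup_image]
  simp [h, ENat.iSup_natCast]

theorem loopMatrix_isSymm {V : Type*} [Fintype V] [DecidableEq V] (G : SimpleGraph V)
    [DecidableRel G.Adj] (u v : V) (Q : ℝ) : (loopMatrix G u v Q).IsSymm := by
  have h (x : V) : (Matrix.single x x (1 : ℝ)).IsSymm := by
    simp [Matrix.IsSymm, Matrix.transpose_single]
  exact G.isSymm_adjMatrix.add (((h u).add (h v)).smul Q)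

/-- The reversal automorphism of the path graph. -/
def pathGraphRev (n : ℕ) : SimpleGraph.pathGraph n ≃g SimpleGraph.pathGraph n where
  toEquiv := Fin.revPerm
  map_rel_iff' := by
    intro a b
    simp only [SimpleGraph.pathGraph_adj, Fin.revPerm_apply, Fin.val_rev]
    omega

theorem _root_.Fin.zero_last_interior_cases {m : ℕ} {P : Fin (m + 2) → Prop} (zero : P 0)
    (last : P (Fin.last (m + 1))) (interior : ∀ i : Fin m, P i.castSucc.succ) (i : Fin (m + 2)) :
    P i := by
  refine Fin.cases zero (fun j => ?_) i
  refine Fin.lastCases ?_ interior j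
  simpa using last

/-! ### The path: degrees and exact eigenvectors -/

section Path

variable {m : ℕ} [DecidableRel (SimpleGraph.pathGraph (m + 2)).Adj]

theorem pathGraph_neighborFinset_zero :
    (SimpleGraph.pathGraph (m + 2)).neighborFinset 0 = {1} := by
  ext j
  simp only [SimpleGraph.mem_neighborFinset, SimpleGraph.pathGraph_adj, Finset.mem_singleton,
    Fin.ext_iff, Fin.val_zero, Fin.val_one]
  omega

theorem pathGraph_neighborFinset_last :
    (SimpleGraph.pathGraph (m + 2)).neighborFinset (Fin.last (m + 1)) =
      {(Fin.last m).castSucc} := by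
  ext j
  simp only [SimpleGraph.mem_neighborFinset, SimpleGraph.pathGraph_adj, Finset.mem_singleton,
    Fin.ext_iff, Fin.val_last, Fin.val_castSucc]
  omega

theorem pathGraph_neighborFinset_interior (i : Fin m) :
    (SimpleGraph.pathGraph (m + 2)).neighborFinset i.castSucc.succ =
      {i.castSucc.castSucc, i.succ.succ} := by
  ext j
  simp only [SimpleGraph.mem_neighborFinset, SimpleGraph.pathGraph_adj, Finset.mem_singleton,
    Finset.mem_insert, Fin.ext_iff, Fin.val_succ, Fin.val_castSucc]
  omega

theorem pathGraph_degree_zero : (SimpleGraph.pathGraph (m + 2)).degree 0 = 1 := by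
  rw [← SimpleGraph.card_neighborFinset_eq_degree, pathGraph_neighborFinset_zero]
  simp

theorem pathGraph_degree_last :
    (SimpleGraph.pathGraph (m + 2)).degree (Fin.last (m + 1)) = 1 := by
  rw [← SimpleGraph.card_neighborFinset_eq_degree, pathGraph_neighborFinset_last]
  simp

theorem pathGraph_degree_interior (i : Fin m) :
    (SimpleGraph.pathGraph (m + 2)).degree i.castSucc.succ = 2 := by
  rw [← SimpleGraph.card_neighborFinset_eq_degree, pathGraph_neighborFinset_interior]
  refine Finset.card_pair ?_
  simp only [ne_eq, Fin.ext_iff, Fin.val_succ, Fin.val_castSucc]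
  omega

theorem genLaplacian_pathGraph (k : ℝ) :
    genLaplacian (SimpleGraph.pathGraph (m + 2)) k =
      loopMatrix (SimpleGraph.pathGraph (m + 2)) 0 (Fin.last (m + 1)) (-k) +
        (2 * k) • (1 : Matrix (Fin (m + 2)) (Fin (m + 2)) ℝ) := by
  have key : (SimpleGraph.pathGraph (m + 2)).degMatrix ℝ =
      (2 : ℝ) • (1 : Matrix (Fin (m + 2)) (Fin (m + 2)) ℝ) - (Matrix.single 0 0 1 +
        Matrix.single (Fin.last (m + 1)) (Fin.last (m + 1)) 1) := by
    ext i j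
    by_cases hij : i = j
    · subst hij
      induction i using Fin.zero_last_interior_cases with
      | zero =>
        have : Fin.last (m + 1) ≠ 0 := by simp [Fin.ext_iff]
        simp [SimpleGraph.degMatrix, pathGraph_degree_zero, this]
        norm_num
      | last =>
        have : (0 : Fin (m + 2)) ≠ Fin.last (m + 1) := by simp [Fin.ext_iff]
        simp [SimpleGraph.degMatrix, pathGraph_degree_last, this]
        norm_num
      | interior i =>
        have h1 : (0 : Fin (m + 2)) ≠ i.castSucc.succ := by simp [Fin.ext_iff]
        have h2 : Fin.last (m + 1) ≠ i.castSucc.succ := by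
          simp only [ne_eq, Fin.ext_iff, Fin.val_succ, Fin.val_castSucc, Fin.val_last]; omega
        simp [SimpleGraph.degMatrix, pathGraph_degree_interior, h1, h2]
    · have h1 : ∀ a : Fin (m + 2), ¬ (a = i ∧ a = j) := fun a h => hij (h.1.symm.trans h.2)
      simp [SimpleGraph.degMatrix, hij, h1]
  rw [genLaplacian, loopMatrix, key, smul_sub, smul_add, smul_add]
  ext i j
  simp only [Matrix.add_apply, Matrix.sub_apply, Matrix.smul_apply, smul_eq_mul]
  ring

theorem phaseEquivalent_pathGraph (k : ℝ) :
    PhaseEquivalent (genLaplacian (SimpleGraph.pathGraph (m + 2)) k)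
      (loopMatrix (SimpleGraph.pathGraph (m + 2)) 0 (Fin.last (m + 1)) (-k)) :=
  ⟨fun t => 2 * k * t, fun t => by rw [genLaplacian_pathGraph, walk_add_smul_one]⟩

/-- The vector `z ^ j + s z ^ (m + 1 - j)`, localized at the two ends of the path. -/
def endVec (m : ℕ) (s z : ℝ) (j : Fin (m + 2)) : ℝ :=
  z ^ (j : ℕ) + s * z ^ (m + 1 - (j : ℕ))

omit [DecidableRel (SimpleGraph.pathGraph (m + 2)).Adj] in
theorem endVec_last {s : ℝ} (hs : s ^ 2 = 1) (z : ℝ) :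
    endVec m s z (Fin.last (m + 1)) = s * endVec m s z 0 := by
  simp [endVec]
  linear_combination (-z ^ (m + 1)) * hs

/-- Both `z^j` and `z^(-j)` solve the interior recurrence with eigenvalue `z + z⁻¹`. Hypothesis `h`
is the row at vertex 0; the last row is `s` times it by reflection. -/
theorem loopMatrix_mulVec_endVec {Q s z : ℝ} (hs : s ^ 2 = 1) (hz : z ≠ 0)
    (h : Q * z * (1 + s * z ^ (m + 1)) = 1 + s * z ^ (m + 3)) :
    loopMatrix (SimpleGraph.pathGraph (m + 2)) 0 (Fin.last (m + 1)) Q *ᵥ endVec m s z =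
      (z + z⁻¹) • endVec m s z := by
  have hloop (i : Fin (m + 2)) :
      (loopMatrix (SimpleGraph.pathGraph (m + 2)) 0 (Fin.last (m + 1)) Q *ᵥ endVec m s z) i =
        ∑ j ∈ (SimpleGraph.pathGraph (m + 2)).neighborFinset i, endVec m s z j +
          Q * ((if i = 0 then endVec m s z 0 else 0) +
            if i = Fin.last (m + 1) then endVec m s z (Fin.last (m + 1)) else 0) := by
    rw [loopMatrix, Matrix.add_mulVec, Pi.add_apply, SimpleGraph.adjMatrix_mulVec_apply,
      Matrix.smul_mulVec, Matrix.add_mulVec, Matrix.single_mulVec, Matrix.single_mulVec]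
    simp [Function.update_apply]
  have hzero : endVec m s z 1 + Q * endVec m s z 0 = (z + z⁻¹) * endVec m s z 0 := by
    simp only [endVec, Fin.val_zero, Fin.val_one, Nat.add_sub_cancel, Nat.sub_zero]
    field_simp
    linear_combination h
  ext i
  rw [hloop, Pi.smul_apply, smul_eq_mul]
  induction i using Fin.zero_last_interior_cases with
  | zero =>
    have : (0 : Fin (m + 2)) ≠ Fin.last (m + 1) := by simp [Fin.ext_iff]
    simpa [pathGraph_neighborFinset_zero, this] using hzero
  | last =>
    have h0 : Fin.last (m + 1) ≠ (0 : Fin (m + 2)) := by simp [Fin.ext_iff]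
    have h1 : endVec m s z (Fin.last m).castSucc = s * endVec m s z 1 := by
      simp only [endVec, Fin.val_castSucc, Fin.val_last, Fin.val_one, Nat.add_sub_cancel,
        Nat.add_sub_cancel_left]
      linear_combination (-z ^ m) * hs
    rw [pathGraph_neighborFinset_last, Finset.sum_singleton, if_neg h0, if_pos rfl, h1,
      endVec_last hs]
    linear_combination s * hzero
  | interior i =>
    have h1 : i.castSucc.succ ≠ (0 : Fin (m + 2)) := by simp [Fin.ext_iff]
    have h2 : i.castSucc.succ ≠ Fin.last (m + 1) := by
      simp only [ne_eq, Fin.ext_iff, Fin.val_succ, Fin.val_castSucc, Fin.val_last]; omega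
    have h3 : i.castSucc.castSucc ≠ i.succ.succ := by
      simp only [ne_eq, Fin.ext_iff, Fin.val_succ, Fin.val_castSucc]; omega
    rw [pathGraph_neighborFinset_interior, Finset.sum_pair h3, if_neg h1, if_neg h2]
    obtain ⟨i, hi⟩ := i
    obtain ⟨d, rfl⟩ : ∃ d, m = i + 1 + d := ⟨m - (i + 1), by omega⟩
    have e1 : i + 1 + d + 1 - i = d + 2 := by omega
    have e2 : i + 1 + d + 1 - (i + 1) = d + 1 := by omega
    have e3 : i + 1 + d + 1 - (i + 1 + 1) = d := by omega
    simp only [endVec, Fin.val_succ, Fin.val_castSucc, e1, e2, e3]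
    field_simp
    ring

end Path

/-! ### Roots of the boundary equation -/

theorem exists_boundary_root (m : ℕ) {Q s : ℝ} (hQ : 40 ≤ |Q|) (hs : |s| = 1) :
    ∃ z : ℝ, z ≠ 0 ∧ |z| ≤ 2 / |Q| ∧
      Q * z * (1 + s * z ^ (m + 1)) = 1 + s * z ^ (m + 3) := by
  have hQ0 : Q ≠ 0 := by rintro rfl; norm_num at hQ
  have hpow : ∀ k : ℕ, |s * (2 / Q) ^ (k + 1)| ≤ 1 / 20 := by
    intro k
    have h1 : |2 / Q| ≤ 1 / 20 := by
      rw [abs_div, abs_two, div_le_iff₀ (by linarith)]; linarith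
    rw [abs_mul, hs, one_mul, abs_pow, pow_succ]
    calc |2 / Q| ^ k * |2 / Q| ≤ 1 * |2 / Q| :=
          mul_le_mul_of_nonneg_right (pow_le_one₀ (abs_nonneg _) (by linarith)) (abs_nonneg _)
      _ ≤ 1 / 20 := by linarith
  -- The substitution `a = Q z` makes `f` nearly `a - 1`, so it changes sign on `[0, 2]` for either
  -- sign of `Q`.
  let f : ℝ → ℝ := fun a => a * (1 + s * (a / Q) ^ (m + 1)) - (1 + s * (a / Q) ^ (m + 3))
  have hf : ContinuousOn f (Set.Icc 0 2) := by fun_prop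
  have h0 : f 0 = -1 := by simp [f]
  have h2 : 0 ≤ f 2 := by
    have h3 := abs_le.mp (hpow m)
    have h4 := abs_le.mp (hpow (m + 2))
    simp only [f]
    linarith [h3.1, h4.2]
  obtain ⟨a, ⟨ha0, ha2⟩, hfa⟩ := intermediate_value_Icc (by norm_num : (0 : ℝ) ≤ 2) hf
    (show (0 : ℝ) ∈ Set.Icc (f 0) (f 2) from ⟨by rw [h0]; norm_num, h2⟩)
  refine ⟨a / Q, div_ne_zero ?_ hQ0, ?_, ?_⟩
  · rintro rfl
    rw [h0] at hfa
    norm_num at hfa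
  · rw [abs_div, abs_of_nonneg ha0]
    gcongr
  · rw [mul_div_cancel₀ _ hQ0]
    exact sub_eq_zero.mp hfa

/-- Equal eigenvalues force `z = z'` or `z z' = 1`. Moduli exclude the latter; in the former, adding
the equations gives `Q z = 1`, and subtracting then gives `z^(m+1) = z^(m+3)`. -/
theorem boundary_roots_ne {m : ℕ} {Q z z' : ℝ} (hz : z ≠ 0) (hz1 : |z| < 1) (hz'1 : |z'| < 1)
    (hz' : z' ≠ 0)
    (h : Q * z * (1 + 1 * z ^ (m + 1)) = 1 + 1 * z ^ (m + 3))
    (h' : Q * z' * (1 + -1 * z' ^ (m + 1)) = 1 + -1 * z' ^ (m + 3)) :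
    z + z⁻¹ ≠ z' + z'⁻¹ := by
  intro heq
  have hfac : (z - z') * (1 - z * z') = 0 := by
    field_simp at heq
    linear_combination -heq
  rcases mul_eq_zero.mp hfac with h1 | h1
  · obtain rfl : z = z' := sub_eq_zero.mp h1
    have h2 : Q * z = 1 := by linear_combination (h + h') / 2
    have h3 : z ^ (m + 1) * (1 - z ^ 2) = 0 := by
      linear_combination (h - h') / 2 - z ^ (m + 1) * h2
    rcases mul_eq_zero.mp h3 with h4 | h4
    · exact pow_ne_zero _ hz h4
    · have := (sq_lt_one_iff_abs_lt_one z).mpr hz1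
      linarith
  · have h2 : |z * z'| < 1 := by
      rw [abs_mul]
      exact mul_lt_one_of_nonneg_of_lt_one_left (abs_nonneg _) hz1 hz'1.le
    have h3 : z * z' = 1 := by linarith
    rw [h3, abs_one] at h2
    exact lt_irrefl _ h2

/-! ### Localization at the ends and transfer -/

theorem sum_range_sq_geom_le {q : ℝ} (h0 : 0 ≤ q) (h1 : q < 1) (m : ℕ) :
    ∑ i ∈ Finset.range m, (q ^ (i + 1)) ^ 2 ≤ q ^ 2 / (1 - q ^ 2) := by
  have hq : q ^ 2 < 1 := pow_lt_one₀ h0 h1 two_ne_zero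
  rw [le_div_iff₀ (by linarith)]
  have h2 : ∑ i ∈ Finset.range m, (q ^ (i + 1)) ^ 2 =
      q ^ 2 * ∑ i ∈ Finset.range m, (q ^ 2) ^ i := by
    rw [Finset.mul_sum]
    exact Finset.sum_congr rfl fun i _ => by ring
  rw [h2, mul_assoc, mul_comm (Finset.sum _ _), mul_neg_geom_sum]
  nlinarith [pow_nonneg (sq_nonneg q) m, sq_nonneg q]

theorem sum_sq_le_of_interior_bound {m : ℕ} {q : ℝ} (h0 : 0 ≤ q) (h1 : q ≤ 1 / 20)
    {f : Fin (m + 2) → ℝ} (hf0 : f 0 = 0) (hfl : f (Fin.last (m + 1)) = 0)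
    (hf : ∀ i : Fin m,
      |f i.castSucc.succ| ≤ (q ^ ((i : ℕ) + 1) + q ^ (m - (i : ℕ))) / (1 - q)) :
    ∑ i, f i ^ 2 ≤ 5 * q ^ 2 := by
  have hg := sum_range_sq_geom_le h0 (by linarith) m
  have hg' : ∑ i ∈ Finset.range m, (q ^ (m - i)) ^ 2 ≤ q ^ 2 / (1 - q ^ 2) := by
    rw [← Finset.sum_range_reflect] at hg
    refine le_trans (Finset.sum_le_sum fun i hi => ?_) hg
    have : m - 1 - i + 1 = m - i := by have := Finset.mem_range.mp hi; omega
    rw [this]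
  have hb : ∀ i : Fin m, f i.castSucc.succ ^ 2 ≤
      2 / (1 - q) ^ 2 * ((q ^ ((i : ℕ) + 1)) ^ 2 + (q ^ (m - (i : ℕ))) ^ 2) := by
    intro i
    calc f i.castSucc.succ ^ 2 ≤ ((q ^ ((i : ℕ) + 1) + q ^ (m - (i : ℕ))) / (1 - q)) ^ 2 :=
          sq_le_sq' (abs_le.mp (hf i)).1 (abs_le.mp (hf i)).2
      _ = 1 / (1 - q) ^ 2 * (q ^ ((i : ℕ) + 1) + q ^ (m - (i : ℕ))) ^ 2 := by
          rw [div_pow, one_div, inv_mul_eq_div]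
      _ ≤ 1 / (1 - q) ^ 2 * (2 * ((q ^ ((i : ℕ) + 1)) ^ 2 + (q ^ (m - (i : ℕ))) ^ 2)) := by
          gcongr
          exact add_sq_le
      _ = _ := by ring
  rw [Fin.sum_univ_succ, Fin.sum_univ_castSucc, Fin.succ_last, hf0, hfl]
  calc (0 : ℝ) ^ 2 + (∑ i : Fin m, f i.castSucc.succ ^ 2 + 0 ^ 2)
      = ∑ i : Fin m, f i.castSucc.succ ^ 2 := by ring
    _ ≤ ∑ i : Fin m, 2 / (1 - q) ^ 2 *
          ((q ^ ((i : ℕ) + 1)) ^ 2 + (q ^ (m - (i : ℕ))) ^ 2) :=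
        Finset.sum_le_sum fun i _ => hb i
    _ = 2 / (1 - q) ^ 2 * (∑ i ∈ Finset.range m, (q ^ (i + 1)) ^ 2 +
          ∑ i ∈ Finset.range m, (q ^ (m - i)) ^ 2) := by
        rw [← Finset.mul_sum, Finset.sum_add_distrib,
          Fin.sum_univ_eq_sum_range (fun i => (q ^ (i + 1)) ^ 2),
          Fin.sum_univ_eq_sum_range (fun i => (q ^ (m - i)) ^ 2)]
    _ ≤ 2 / (1 - q) ^ 2 * (q ^ 2 / (1 - q ^ 2) + q ^ 2 / (1 - q ^ 2)) := by gcongr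
    _ = q ^ 2 * (4 / ((1 - q) ^ 2 * (1 - q ^ 2))) := by
        have : 1 - q ≠ 0 := by linarith
        have : 1 - q ^ 2 ≠ 0 := by nlinarith
        field_simp
        ring
    _ ≤ q ^ 2 * 5 := by
        gcongr
        -- The constant 5 works because `5 · (9/10) · (99/100) > 4`.
        have ha : (9 / 10 : ℝ) ≤ (1 - q) ^ 2 := by nlinarith
        have hc : (99 / 100 : ℝ) ≤ 1 - q ^ 2 := by nlinarith
        rw [div_le_iff₀ (by positivity)]
        nlinarith [mul_le_mul ha hc (by norm_num) (by positivity)]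
    _ = 5 * q ^ 2 := mul_comm _ _

/-- `endVec` scaled to have value `1` at the first vertex. -/
def endVecUnit (m : ℕ) (s z : ℝ) (j : Fin (m + 2)) : ℝ :=
  (endVec m s z 0)⁻¹ * endVec m s z j

theorem one_sub_le_endVec_zero {m : ℕ} {s z q : ℝ} (hs : |s| = 1) (hz : |z| ≤ q) (hq : q ≤ 1) :
    1 - q ≤ endVec m s z 0 := by
  have h1 : |s * z ^ (m + 1)| ≤ q := by
    rw [abs_mul, hs, one_mul, abs_pow, pow_succ]
    calc |z| ^ m * |z| ≤ 1 * |z| :=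
          mul_le_mul_of_nonneg_right (pow_le_one₀ (abs_nonneg _) (by linarith)) (abs_nonneg _)
      _ ≤ q := by linarith
  have := (abs_le.mp h1).1
  simp only [endVec, Fin.val_zero, pow_zero, Nat.sub_zero]
  linarith

theorem endVecUnit_zero {m : ℕ} {s z : ℝ} (h : endVec m s z 0 ≠ 0) : endVecUnit m s z 0 = 1 :=
  inv_mul_cancel₀ h

/-- With end values exactly 1 and `s`, the half-sum and half-difference of the two eigenvectors
agree with `e_u` and `e_v` at both ends, leaving only interior error. -/
theorem endVecUnit_last {m : ℕ} {s z : ℝ} (hs : s ^ 2 = 1) (h : endVec m s z 0 ≠ 0) :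
    endVecUnit m s z (Fin.last (m + 1)) = s := by
  rw [endVecUnit, endVec_last hs, mul_left_comm, inv_mul_cancel₀ h, mul_one]

theorem abs_endVecUnit_interior_le {m : ℕ} {s z q : ℝ} (hs : |s| = 1) (hz : |z| ≤ q) (hq : q < 1)
    (i : Fin m) :
    |endVecUnit m s z i.castSucc.succ| ≤ (q ^ ((i : ℕ) + 1) + q ^ (m - (i : ℕ))) / (1 - q) := by
  have h0 := one_sub_le_endVec_zero (m := m) hs hz hq.le
  have hpos : 0 < 1 - q := by linarith
  rw [endVecUnit, ← div_eq_inv_mul, abs_div, abs_of_pos (hpos.trans_le h0)]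
  have h1 : |endVec m s z i.castSucc.succ| ≤ q ^ ((i : ℕ) + 1) + q ^ (m - (i : ℕ)) := by
    simp only [endVec, Fin.val_succ, Fin.val_castSucc, Nat.add_sub_add_right]
    refine (abs_add_le _ _).trans ?_
    rw [abs_mul, hs, one_mul, abs_pow, abs_pow]
    gcongr
  have hq0 : 0 ≤ q := (abs_nonneg z).trans hz
  gcongr

theorem loopMatrix_mulVec_endVecUnit {m : ℕ} [DecidableRel (SimpleGraph.pathGraph (m + 2)).Adj]
    {Q s z : ℝ} (hs : s ^ 2 = 1) (hz : z ≠ 0)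
    (h : Q * z * (1 + s * z ^ (m + 1)) = 1 + s * z ^ (m + 3)) :
    loopMatrix (SimpleGraph.pathGraph (m + 2)) 0 (Fin.last (m + 1)) Q *ᵥ endVecUnit m s z =
      (z + z⁻¹) • endVecUnit m s z := by
  have : endVecUnit m s z = (endVec m s z 0)⁻¹ • endVec m s z := rfl
  rw [this, Matrix.mulVec_smul, loopMatrix_mulVec_endVec hs hz h, smul_comm]

/-- Two distinct real frequencies are in antiphase at some positive time. -/
theorem exists_antiphase {a b : ℝ} (h : a ≠ b) :
    ∃ t : ℝ, 0 < t ∧ Complex.exp (Complex.I * t * b) = -Complex.exp (Complex.I * t * a) := by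
  have hab : a - b ≠ 0 := sub_ne_zero.mpr h
  have habC : (a : ℂ) - b ≠ 0 := by exact_mod_cast hab
  rcases lt_or_gt_of_ne h with hlt | hgt
  · refine ⟨Real.pi / (b - a), div_pos Real.pi_pos (by linarith), ?_⟩
    have habC' : (b : ℂ) - a ≠ 0 := by rw [← neg_sub]; exact neg_ne_zero.mpr habC
    have : Complex.I * ((Real.pi / (b - a) : ℝ) : ℂ) * b =
        Complex.I * ((Real.pi / (b - a) : ℝ) : ℂ) * a + Real.pi * Complex.I := by
      push_cast
      field_simp
      ring
    rw [this, Complex.exp_add, Complex.exp_pi_mul_I, mul_neg_one]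
  · refine ⟨Real.pi / (a - b), div_pos Real.pi_pos (by linarith), ?_⟩
    have : Complex.I * ((Real.pi / (a - b) : ℝ) : ℂ) * a =
        Complex.I * ((Real.pi / (a - b) : ℝ) : ℂ) * b + Real.pi * Complex.I := by
      push_cast
      field_simp
      ring
    rw [this, Complex.exp_add, Complex.exp_pi_mul_I, mul_neg_one, neg_neg]

theorem norm_toLp_ofReal_sq {V : Type*} [Fintype V] (f : V → ℝ) :
    ‖WithLp.toLp 2 (fun i => (f i : ℂ))‖ ^ 2 = ∑ i, f i ^ 2 := by
  simp [EuclideanSpace.norm_sq_eq]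

/-- Large loops at the ends of a path give fidelity `1 - O(1 / Q²)` between the ends. -/
theorem exists_norm_walk_loopMatrix_ge {m : ℕ} [DecidableRel (SimpleGraph.pathGraph (m + 2)).Adj]
    {Q : ℝ} (hQ : 40 ≤ |Q|) :
    ∃ t : ℝ, 0 < t ∧ 1 - 40 / Q ^ 2 ≤
      ‖walk (loopMatrix (SimpleGraph.pathGraph (m + 2)) 0 (Fin.last (m + 1)) Q) t
        0 (Fin.last (m + 1))‖ := by
  set q : ℝ := 2 / |Q| with hq
  have hQpos : 0 < |Q| := by linarith
  have hq0 : 0 ≤ q := by positivity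
  have hq1 : q ≤ 1 / 20 := by rw [hq, div_le_iff₀ hQpos]; linarith
  have hs1 : |(1 : ℝ)| = 1 := abs_one
  have hs2 : |(-1 : ℝ)| = 1 := by simp
  have hs1' : (1 : ℝ) ^ 2 = 1 := one_pow 2
  have hs2' : (-1 : ℝ) ^ 2 = 1 := by norm_num
  obtain ⟨z, hz0, hzq, hz⟩ := exists_boundary_root m hQ hs1
  obtain ⟨z', hz'0, hz'q, hz'⟩ := exists_boundary_root m hQ hs2
  rw [← hq] at hzq hz'q
  obtain ⟨t, ht, hanti⟩ := exists_antiphase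
    (boundary_roots_ne hz0 (by linarith) (by linarith) hz'0 hz hz')
  refine ⟨t, ht, ?_⟩
  have hx0 : endVec m 1 z 0 ≠ 0 :=
    (lt_of_lt_of_le (by linarith) (one_sub_le_endVec_zero hs1 hzq (by linarith))).ne'
  have hx'0 : endVec m (-1) z' 0 ≠ 0 :=
    (lt_of_lt_of_le (by linarith) (one_sub_le_endVec_zero hs2 hz'q (by linarith))).ne'
  have hU := walk_mulVec_eigenvector (loopMatrix_mulVec_endVecUnit hs1' hz0 hz) t
  have hU' := walk_mulVec_eigenvector (loopMatrix_mulVec_endVecUnit hs2' hz'0 hz') t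
  rw [hanti] at hU'
  have hx1 := endVecUnit_zero hx0
  have hx'1 := endVecUnit_zero hx'0
  have hxl := endVecUnit_last hs1' hx0
  have hx'l := endVecUnit_last hs2' hx'0
  have hxi := abs_endVecUnit_interior_le (m := m) hs1 hzq (by linarith)
  have hx'i := abs_endVecUnit_interior_le (m := m) hs2 hz'q (by linarith)
  set x := endVecUnit m 1 z
  set x' := endVecUnit m (-1) z'
  set ω := Complex.exp (Complex.I * t * ((z + z⁻¹ : ℝ) : ℂ)) with hω
  have hωn : ‖ω‖ = 1 := by
    rw [hω, mul_assoc, ← Complex.ofReal_mul, mul_comm, Complex.norm_exp_ofReal_mul_I]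
  have hne : (0 : Fin (m + 2)) ≠ Fin.last (m + 1) := by simp [Fin.ext_iff]
  have hint : ∀ i : Fin m, i.castSucc.succ ≠ (0 : Fin (m + 2)) ∧
      i.castSucc.succ ≠ Fin.last (m + 1) := by
    intro i
    simp only [ne_eq, Fin.ext_iff, Fin.val_succ, Fin.val_castSucc, Fin.val_last, Fin.val_zero]
    omega
  have hbound : ∀ (a : Fin (m + 2)) (f : Fin (m + 2) → ℝ),
      ∑ i, ((Pi.single a (1 : ℝ) : Fin (m + 2) → ℝ) i - f i) ^ 2 ≤ 5 * q ^ 2 →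
      ‖WithLp.toLp 2 (Pi.single a (1 : ℂ) - fun i => (f i : ℂ))‖ ≤ Real.sqrt (5 * q ^ 2) := by
    intro a f h
    apply Real.le_sqrt_of_sq_le
    rw [← norm_toLp_ofReal_sq] at h
    convert h using 5 with i
    by_cases hi : i = a
    · subst hi; simp
    · simp [hi]
  have hw : ∑ i, ((Pi.single 0 (1 : ℝ) : Fin (m + 2) → ℝ) i - (x i + x' i) / 2) ^ 2
      ≤ 5 * q ^ 2 := by
    refine sum_sq_le_of_interior_bound hq0 hq1 (by simp [hx1, hx'1]) ?_ fun i => ?_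
    · simp [hxl, hx'l, hne.symm]
    · rw [Pi.single_eq_of_ne (hint i).1]
      have h1 := abs_le.mp (hxi i)
      have h2 := abs_le.mp (hx'i i)
      exact abs_le.mpr ⟨by linarith, by linarith⟩
  have hw' : ∑ i, ((Pi.single (Fin.last (m + 1)) (1 : ℝ) : Fin (m + 2) → ℝ) i -
      (x i - x' i) / 2) ^ 2 ≤ 5 * q ^ 2 := by
    refine sum_sq_le_of_interior_bound hq0 hq1 (by simp [hx1, hx'1, hne]) ?_ fun i => ?_
    · simp [hxl, hx'l]
    · rw [Pi.single_eq_of_ne (hint i).2]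
      have h1 := abs_le.mp (hxi i)
      have h2 := abs_le.mp (hx'i i)
      exact abs_le.mpr ⟨by linarith, by linarith⟩
  have hmain := Matrix.one_sub_le_norm_apply_of_mem_unitaryGroup
    (walk_mem_unitaryGroup (loopMatrix_isSymm (SimpleGraph.pathGraph (m + 2)) 0
      (Fin.last (m + 1)) Q) t) 0 (Fin.last (m + 1)) hωn (w := fun i => (((x i + x' i) / 2 : ℝ) : ℂ))
      (w' := fun i => (((x i - x' i) / 2 : ℝ) : ℂ)) ?_ (hbound _ _ hw) (hbound _ _ hw')
  · refine le_trans (le_of_eq ?_) hmain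
    -- Here `2δ² = 10 q² = 40 / Q²`.
    rw [Real.sq_sqrt (by positivity), hq, div_pow, sq_abs]
    ring
  · have e : (fun i => (((x i - x' i) / 2 : ℝ) : ℂ)) =
        (1 / 2 : ℂ) • ((fun i => (x i : ℂ)) - fun i => (x' i : ℂ)) := by
      ext i
      simp
      ring
    rw [e, Matrix.mulVec_smul, Matrix.mulVec_sub, hU, hU']
    ext i
    simp
    ring

/-! ### Conclusions for the path -/

theorem cospectrality_pathGraph (m : ℕ) :
    cospectrality (SimpleGraph.pathGraph (m + 2)) 0 (Fin.last (m + 1)) = ⊤ := by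
  classical
  refine cospectrality_eq_top fun l => ?_
  rw [← closedWalkCount_iso (pathGraphRev (m + 2)) 0 l]
  congr 1

theorem one_sub_lt_peakFidelity_pathGraph {m : ℕ}
    [DecidableRel (SimpleGraph.pathGraph (m + 2)).Adj] {k ε : ℝ} (hε : 0 < ε)
    (hk : 32 * Real.sqrt 2 / Real.sqrt ε < |k|) :
    1 - ε < peakFidelity (genLaplacian (SimpleGraph.pathGraph (m + 2)) k) 0 (Fin.last (m + 1)) := by
  -- For `ε > 1` the bound is trivial; `ε ≤ 1` forces `k² > 2048 > 40²`, as the transfer estimate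
  -- requires.
  rcases lt_or_ge 1 ε with h1 | h1
  · exact lt_of_lt_of_le (by linarith) (peakFidelity_nonneg _ _ _)
  have hsq : 2048 / ε < k ^ 2 := by
    have h := pow_lt_pow_left₀ hk (by positivity) two_ne_zero
    rw [sq_abs, div_pow, mul_pow, Real.sq_sqrt zero_le_two, Real.sq_sqrt hε.le] at h
    norm_num at h
    exact h
  have hkε : 2048 < k ^ 2 * ε := (div_lt_iff₀ hε).mp hsq
  have hk2 : 2048 < k ^ 2 := by nlinarith [sq_nonneg k]
  have hQ : 40 ≤ |-k| := by
    rw [abs_neg]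
    nlinarith [abs_nonneg k, sq_abs k]
  obtain ⟨t, ht, hfid⟩ := exists_norm_walk_loopMatrix_ge (m := m) hQ
  rw [(phaseEquivalent_pathGraph k).peakFidelity_eq]
  refine lt_of_lt_of_le ?_ (hfid.trans (norm_walk_apply_le_peakFidelity
    (loopMatrix_isSymm _ _ _ _) _ _ ht))
  have : 40 / (-k) ^ 2 < ε := by
    rw [neg_sq, div_lt_iff₀ (by linarith)]
    linarith
  linarith

end QuantumWalk

end

theorem mainTheorem4 (n : ℕ) (hn : 2 ≤ n) (u v : Fin n)
    (hu : (u : ℕ) = 0) (hv : (v : ℕ) = n - 1)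
    [DecidableRel (SimpleGraph.pathGraph n).Adj] :
    QuantumWalk.cospectrality (SimpleGraph.pathGraph n) u v = ⊤ ∧
    ((SimpleGraph.pathGraph n).degree u = 1 ∧ (SimpleGraph.pathGraph n).degree v = 1 ∧
      ∀ x : Fin n, x ≠ u → x ≠ v → (SimpleGraph.pathGraph n).degree x = 2) ∧
    (∀ k : ℝ, QuantumWalk.PhaseEquivalent
      (QuantumWalk.genLaplacian (SimpleGraph.pathGraph n) k)
      (QuantumWalk.loopMatrix (SimpleGraph.pathGraph n) u v (-k))) ∧
    ∀ k ε : ℝ, 0 < ε → 32 * Real.sqrt 2 / Real.sqrt ε < |k| →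
      1 - ε < QuantumWalk.peakFidelity
        (QuantumWalk.genLaplacian (SimpleGraph.pathGraph n) k) u v := by
  obtain ⟨m, rfl⟩ : ∃ m, n = m + 2 := ⟨n - 2, by omega⟩
  obtain rfl : u = 0 := Fin.ext hu
  obtain rfl : v = Fin.last (m + 1) := Fin.ext hv
  refine ⟨QuantumWalk.cospectrality_pathGraph m,
    ⟨QuantumWalk.pathGraph_degree_zero, QuantumWalk.pathGraph_degree_last, fun x => ?_⟩,
    QuantumWalk.phaseEquivalent_pathGraph,
    fun k ε => QuantumWalk.one_sub_lt_peakFidelity_pathGraph⟩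
  induction x using Fin.zero_last_interior_cases with
  | zero => exact fun h => absurd rfl h
  | last => exact fun _ h => absurd rfl h
  | interior i => exact fun _ _ => QuantumWalk.pathGraph_degree_interior i
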